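/- Let $d\ge 1$ be an integer. For every $n$ let $A_n$ be a quantum system with Hilbert space $\mathcal H_A^{(n)}$ of dimension $d^n$, let $B_n$ be a quantum system with an arbitrary finite-dimensional Hilbert space $\mathcal H_B^{(n)}$, and let $\rho^{AB}_n$ be an arbitrary state (positive operator of unit trace) on $\mathcal H_A^{(n)}\otimes\mathcal H_B^{(n)}$, shared by Alice (system $A_n$) and Bob (system $B_n$). All logarithms are natural. *Dense coding capacity.* A code of size $M$ for block length $n$ consists of completely positive trace-preserving (CPTP) maps $\mathcal E_1,\dots,\mathcal E_{M}$ on $\mathcal B(\mathcal H_A^{(n)})$ and positive operators $E_1,\dots,E_{M}$ on $\mathcal H_A^{(n)}\otimes\mathcal H_B^{(n)}$ with $\sum_i E_i\le I$; its average probability of error is $$P_e=\frac1{M}\sum_{i=1}^{M}\bigl(1-\mathrm{Tr}[(\mathcal E_{i}\otimes\mathrm{id}_B)(\rho_n^{AB})\,E_{i}]\bigr).$$ A real number $R$ is an achievable rate if there are codes $\mathcal C^{(n)}$ of sizes $M_n$ with $M_n\ge e^{nR}$ for all sufficiently large $n$ and $P_e(\mathcal C^{(n)})\to0$ as $n\to\infty$.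 The dense coding capacity $C_{DC}$ is the supremum of all achievable rates. *Spectral sup-conditional entropy rate.* For a self-adjoint operator $X$ let $\{X\ge0\}$ be the projection onto the span of its eigenvectors with eigenvalues $\ge0$. For a sequence of states $\sigma=\{\sigma_n\}$ on $\mathcal H_A^{(n)}\otimes\mathcal H_B^{(n)}$ with reduced states $\sigma_n^B=\mathrm{Tr}_A\sigma_n$ put $\Pi_n(\gamma)=\sigma_n-e^{n\gamma}\,I_n^A\otimes\sigma_n^B$ and $$\overline S_\sigma(A|B)=-\sup\Bigl\{\gamma\in\mathbb R:\ \liminf_{n\to\infty}\mathrm{Tr}\bigl[\{\Pi_n(\gamma)\ge0\}\,\Pi_n(\gamma)\bigr]=1\Bigr\}.$$ For a sequence $\Lambda=\{\Lambda_n\}$ of CPTP maps $\Lambda_n$ on $\mathcal B(\mathcal H_A^{(n)})$ let $\overline S(\Lambda A|B)$ be this quantity for $\sigma_n=(\Lambda_n\otimes\mathrm{id}_B)(\rho_n^{AB})$. Theorem. The minimum of $\overline S(\Lambda A|B)$ over all sequences $\Lambda$ of CPTP maps on Alice's systems is attained and is a real number, and $$C_{DC}=\log d-\min_{\Lambda}\overline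 S(\Lambda A|B).$$ -/

import Mathlib

open Filter Topology
open scoped Kronecker ComplexOrder

/-! ### States, channels and spectral projections in finite dimension

A finite-dimensional Hilbert space with an orthonormal basis indexed by `ι` is `ℂ ^ ι`, its operators
are the matrices `Matrix ι ι ℂ`, and the tensor product of two such spaces has the basis indexed by
the product of the two index types. -/

/-- A state: a positive operator of unit trace. -/
structure IsState {ι : Type*} [Fintype ι] (ρ : Matrix ι ι ℂ) : Prop where
  posSemidef : ρ.PosSemidef
  trace_eq_one : ρ.trace = 1

/-- The map `Φ ⊗ id` on operators of a bipartite system, `Φ` acting on the first factor. -/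
def applyLeft {ι κ β : Type*} (Φ : Matrix ι ι ℂ →ₗ[ℂ] Matrix κ κ ℂ)
    (X : Matrix (ι × β) (ι × β) ℂ) : Matrix (κ × β) (κ × β) ℂ :=
  Matrix.of fun p q => Φ (Matrix.of fun i j => X (i, p.2) (j, q.2)) p.1 q.1

/-- On product operators `Φ ⊗ id` is what it should be (it is linear in its argument by definition,
and the product operators span). -/
theorem applyLeft_kronecker {ι κ β : Type*} (Φ : Matrix ι ι ℂ →ₗ[ℂ] Matrix κ κ ℂ)
    (A : Matrix ι ι ℂ) (B : Matrix β β ℂ) : applyLeft Φ (A ⊗ₖ B) = Φ A ⊗ₖ B := by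
  ext p q
  have h : (Matrix.of fun i j => (A ⊗ₖ B) (i, p.2) (j, q.2)) = B p.2 q.2 • A := by
    ext i j
    simp [Matrix.kroneckerMap_apply, mul_comm]
  simp only [applyLeft, Matrix.of_apply, h]
  simp [Matrix.kroneckerMap_apply, mul_comm]

/-- Completely positive trace-preserving linear maps: `Φ ⊗ id_k` preserves positivity for every `k`,
and `Φ` preserves the trace. -/
structure IsCPTP {ι κ : Type*} [Fintype ι] [Fintype κ]
    (Φ : Matrix ι ι ℂ →ₗ[ℂ] Matrix κ κ ℂ) : Prop where
  completelyPositive : ∀ (k : ℕ) (X : Matrix (ι × Fin k) (ι × Fin k) ℂ),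
    X.PosSemidef → (applyLeft Φ X).PosSemidef
  tracePreserving : ∀ X : Matrix ι ι ℂ, (Φ X).trace = X.trace

/-- The reduced operator on the second factor: the partial trace over the first factor. -/
def reducedRight {α β : Type*} [Fintype α] (X : Matrix (α × β) (α × β) ℂ) : Matrix β β ℂ :=
  Matrix.of fun b b' => ∑ a, X (a, b) (a, b')

/-- The spectral projection `{A ≥ 0}` of a self-adjoint operator `A`: the sum of the eigenprojections
of the eigenvalues `≥ 0`, that is, the indicator function of `[0, ∞)` applied to `A`. -/
noncomputable def nonnegProj {ι : Type*} [Fintype ι] [DecidableEq ι] (A : Matrix ι ι ℂ) :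
    Matrix ι ι ℂ :=
  cfc (Set.indicator (Set.Ici (0 : ℝ)) (fun _ => (1 : ℝ))) A

/-! ### Spectral divergence and conditional entropy rates -/

/-- The difference operator `Π_n(γ) = ρ_n - e^{nγ} ω_n`. -/
noncomputable def differenceOp {ι : ℕ → Type*} (ρ ω : ∀ n, Matrix (ι n) (ι n) ℂ)
    (γ : ℝ) (n : ℕ) : Matrix (ι n) (ι n) ℂ :=
  ρ n - ((Real.exp (n * γ) : ℝ) : ℂ) • ω n

/-- The quantum spectral inf-divergence rate of `ρ` with respect to `ω`: the supremum of the
real `γ` with `liminf Tr[{Π_n(γ) ≥ 0} Π_n(γ)] = 1`. -/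
noncomputable def spectralInfDivergence {ι : ℕ → Type*} [∀ n, Fintype (ι n)]
    [∀ n, DecidableEq (ι n)] (ρ ω : ∀ n, Matrix (ι n) (ι n) ℂ) : EReal :=
  ⨆ γ ∈ {γ : ℝ | liminf (fun n : ℕ =>
      (((nonnegProj (differenceOp ρ ω γ n) * differenceOp ρ ω γ n).trace.re : ℝ) : EReal))
      atTop = 1}, (γ : EReal)

/-- The spectral sup-conditional entropy rate of a sequence of bipartite states,
`S̄(A|B) = - D̲(ρ^{AB} ‖ I^A ⊗ ρ^B)`. -/
noncomputable def spectralSupCondEntropy {α β : ℕ → Type*} [∀ n, Fintype (α n)]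
    [∀ n, DecidableEq (α n)] [∀ n, Fintype (β n)] [∀ n, DecidableEq (β n)]
    (ρ : ∀ n, Matrix (α n × β n) (α n × β n) ℂ) : EReal :=
  -spectralInfDivergence ρ (fun n => (1 : Matrix (α n) (α n) ℂ) ⊗ₖ reducedRight (ρ n))

/-! ### Dense coding -/

/-- A dense coding code of size `M` for the bipartite system with parts `α` (Alice) and `β` (Bob):
the message `i` is encoded by a CPTP map on Alice's part, which is then sent through the noiseless
channel; Bob measures the whole system with a (possibly incomplete) POVM. -/
structure DenseCode (α β : Type*) [Fintype α] [Fintype β] [DecidableEq α] [DecidableEq β]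
    (M : ℕ) where
  enc : Fin M → (Matrix α α ℂ →ₗ[ℂ] Matrix α α ℂ)
  enc_isCPTP : ∀ i, IsCPTP (enc i)
  dec : Fin M → Matrix (α × β) (α × β) ℂ
  dec_posSemidef : ∀ i, (dec i).PosSemidef
  dec_sum_le_one : (1 - ∑ i, dec i).PosSemidef

/-- The average probability of error of a code that is used on the shared state `ρ`. -/
noncomputable def DenseCode.error {α β : Type*} [Fintype α] [Fintype β] [DecidableEq α]
    [DecidableEq β] {M : ℕ} (C : DenseCode α β M) (ρ : Matrix (α × β) (α × β) ℂ) : ℝ :=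
  (1 / (M : ℝ)) * ∑ i, (1 - (applyLeft (C.enc i) ρ * C.dec i).trace.re)

/-- The rate `R` is achievable: there are codes of sizes `M_n`, with `M_n ≥ e^{nR}` for all large
`n`, whose average probability of error tends to `0`. -/
def IsAchievableRate {α β : ℕ → Type*} [∀ n, Fintype (α n)]
    [∀ n, DecidableEq (α n)] [∀ n, Fintype (β n)] [∀ n, DecidableEq (β n)]
    (ρ : ∀ n, Matrix (α n × β n) (α n × β n) ℂ) (R : ℝ) : Prop :=
  ∃ (M : ℕ → ℕ) (C : ∀ n, DenseCode (α n) (β n) (M n)),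
    (∃ N : ℕ, ∀ n ≥ N, Real.exp (n * R) ≤ (M n : ℝ)) ∧
      Tendsto (fun n => (C n).error (ρ n)) atTop (𝓝 0)

/-- The dense coding capacity: the supremum of the achievable rates. -/
noncomputable def denseCodingCapacity {α β : ℕ → Type*} [∀ n, Fintype (α n)]
    [∀ n, DecidableEq (α n)] [∀ n, Fintype (β n)] [∀ n, DecidableEq (β n)]
    (ρ : ∀ n, Matrix (α n × β n) (α n × β n) ℂ) : EReal :=
  ⨆ R ∈ {R : ℝ | IsAchievableRate ρ R}, (R : EReal)

/-! Let v(σ, c) be the maximum of Tr T(σ - c 1⊗σ_B) over tests 0 ≤ T ≤ 1; it is attained at the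
projection {σ - c 1⊗σ_B ≥ 0} and is at most 1. A rate γ is admissible for σ iff v(σ_n, e^{nγ}) → 1.
A channel on Alice's side leaves Bob's state unchanged, so all preprocessed states share the
reference operator Q = 1⊗ρ_B, whose trace is d^n.

Direct part (`exists_denseCode`): preprocess by Λ, then encode by independent random Weyl unitaries.
Each signal passes its own rotated test with the original probability, while the average signal is
Q/d^n, so a wrong test fires with probability Tr[TQ]/d^n, at most (1 - v)/(c d^n) for the optimal
test. By `hayashi_nagaoka` the square-root measurement turns these tests into a decoder. For c =
e^{nγ} and about e^{n(log d + γ)} messages the error is at most 6(1 - v) + o(1).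

Converse (`DenseCode.exists_le_testValue`): the decoding operators sum to at most 1, so their
Q-traces sum to at most d^n. Used as tests and averaged over messages, they give some encoder with v
≥ 1 - P_e - c d^n/M, and these encoders serve as Λ.

Hence the capacity is log d + a, with a the supremum of the rates reachable by preprocessing. A
diagonal argument (`exists_optimal_preprocessing`) yields one sequence Λ good for every rate below
a, so the minimum is attained and equals -a. -/

/-! ### Trace inequalities for positive matrices -/

section MatrixInequalities

open scoped MatrixOrder

variable {ι : Type*} [Fintype ι] [DecidableEq ι]

theorem Matrix.PosSemidef.re_trace_mul_nonneg {A B : Matrix ι ι ℂ} (hA : A.PosSemidef)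
    (hB : B.PosSemidef) : 0 ≤ (A * B).trace.re := by
  have h := CFC.sqrt_mul_sqrt_self A hA.nonneg
  have hS : (CFC.sqrt A).PosSemidef := Matrix.nonneg_iff_posSemidef.1 (CFC.sqrt_nonneg A)
  have h2 := (hB.mul_mul_conjTranspose_same (CFC.sqrt A)).trace_nonneg
  rw [hS.isHermitian.eq, Matrix.trace_mul_comm, ← mul_assoc, h] at h2
  exact (Complex.le_def.1 h2).1

/-- Monotonicity of `A ↦ Tr[A B]` for positive `B`. -/
theorem re_trace_mul_le_of_le {A A' B : Matrix ι ι ℂ} (h : A ≤ A') (hB : B.PosSemidef) :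
    (A * B).trace.re ≤ (A' * B).trace.re := by
  have := (Matrix.le_iff.1 h).re_trace_mul_nonneg hB
  rw [sub_mul, Matrix.trace_sub, Complex.sub_re] at this
  linarith

/-! ### Optimality of the spectral projection -/

section SpectralProjection

variable {A : Matrix ι ι ℂ}

theorem continuousOn_spectrum (A : Matrix ι ι ℂ) (f : ℝ → ℝ) : ContinuousOn f (spectrum ℝ A) :=
  A.finite_real_spectrum.continuousOn f

theorem nonnegProj_isHermitian (A : Matrix ι ι ℂ) : (nonnegProj A).IsHermitian :=
  cfc_predicate (R := ℝ) (p := IsSelfAdjoint) _ A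

theorem nonnegProj_mul_self (A : Matrix ι ι ℂ) : nonnegProj A * nonnegProj A = nonnegProj A := by
  unfold nonnegProj
  rw [← cfc_mul _ _ A (continuousOn_spectrum A _) (continuousOn_spectrum A _)]
  congr 1
  ext x
  by_cases hx : x ∈ Set.Ici (0 : ℝ) <;> simp [Set.indicator, hx]

theorem nonnegProj_posSemidef (A : Matrix ι ι ℂ) : (nonnegProj A).PosSemidef := by
  have h := Matrix.posSemidef_conjTranspose_mul_self (nonnegProj A)
  rwa [(nonnegProj_isHermitian A).eq, nonnegProj_mul_self] at h

theorem one_sub_nonnegProj_posSemidef (A : Matrix ι ι ℂ) : (1 - nonnegProj A).PosSemidef := by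
  have h := Matrix.posSemidef_conjTranspose_mul_self (1 - nonnegProj A)
  rw [Matrix.conjTranspose_sub, (nonnegProj_isHermitian A).eq, Matrix.conjTranspose_one] at h
  have e : (1 - nonnegProj A) * (1 - nonnegProj A) = 1 - nonnegProj A := by
    rw [sub_mul, mul_sub, mul_sub, nonnegProj_mul_self]; simp
  rwa [e] at h

theorem nonnegProj_mul_posSemidef (hA : A.IsHermitian) : (nonnegProj A * A).PosSemidef := by
  have hA' : IsSelfAdjoint A := hA
  have h : nonnegProj A * A =
      cfc (fun x => Set.indicator (Set.Ici (0 : ℝ)) (fun _ => (1 : ℝ)) x * x) A := by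
    rw [cfc_mul _ _ A (continuousOn_spectrum A _) (continuousOn_spectrum A _),
      cfc_id' ℝ A hA']
    rfl
  rw [h, ← Matrix.nonneg_iff_posSemidef]
  refine cfc_nonneg fun x _ => ?_
  by_cases hx : 0 ≤ x <;> simp [Set.indicator, hx]

theorem nonnegProj_mul_sub_posSemidef (hA : A.IsHermitian) :
    (nonnegProj A * A - A).PosSemidef := by
  have hA' : IsSelfAdjoint A := hA
  have h : nonnegProj A * A - A =
      cfc (fun x => Set.indicator (Set.Ici (0 : ℝ)) (fun _ => (1 : ℝ)) x * x - x) A := by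
    rw [cfc_sub _ _ A (continuousOn_spectrum A _) (continuousOn_spectrum A _),
      cfc_mul _ _ A (continuousOn_spectrum A _) (continuousOn_spectrum A _),
      cfc_id' ℝ A hA']
    rfl
  rw [h, ← Matrix.nonneg_iff_posSemidef]
  refine cfc_nonneg fun x _ => ?_
  by_cases hx : 0 ≤ x
  · simp [Set.indicator, hx]
  · simp [Set.indicator, hx, (not_le.1 hx).le]

/-- The spectral projection `{A ≥ 0}` maximizes `Tr[T A]` over the tests `0 ≤ T ≤ 1`. -/
theorem re_trace_mul_le_nonnegProj {T : Matrix ι ι ℂ} (hA : A.IsHermitian) (hT : T.PosSemidef)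
    (hT1 : (1 - T).PosSemidef) : (T * A).trace.re ≤ (nonnegProj A * A).trace.re := by
  have h1 := hT.re_trace_mul_nonneg (nonnegProj_mul_sub_posSemidef hA)
  have h2 := hT1.re_trace_mul_nonneg (nonnegProj_mul_posSemidef hA)
  rw [mul_sub, Matrix.trace_sub, Complex.sub_re] at h1
  rw [sub_mul, one_mul, Matrix.trace_sub, Complex.sub_re] at h2
  linarith

end SpectralProjection

/-! ### The Hayashi–Nagaoka inequality -/

section HayashiNagaoka

open scoped Matrix.Norms.L2Operator

/-- A projection is its own square root, and the square root is operator monotone. -/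
theorem le_sqrt_of_mul_self_eq {S G : Matrix ι ι ℂ} (hS : S.PosSemidef) (hSS : S * S = S)
    (h : S ≤ G) : S ≤ CFC.sqrt G := by
  have h1 : CFC.sqrt S = S := (CFC.sqrt_eq_iff S S hS.nonneg hS.nonneg).2 hSS
  calc S = CFC.sqrt S := h1.symm
    _ ≤ CFC.sqrt G := CFC.sqrt_le_sqrt S G h

theorem isUnit_det_sqrt {G : Matrix ι ι ℂ} (hG : G.PosDef) : IsUnit (CFC.sqrt G).det := by
  have h := (Matrix.isUnit_iff_isUnit_det _).1 hG.isUnit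
  rw [← CFC.sqrt_mul_sqrt_self G hG.posSemidef.nonneg, Matrix.det_mul] at h
  exact isUnit_of_mul_isUnit_left h

theorem isHermitian_inv_sqrt (G : Matrix ι ι ℂ) : ((CFC.sqrt G)⁻¹).IsHermitian :=
  (Matrix.nonneg_iff_posSemidef.1 (CFC.sqrt_nonneg G)).isHermitian.inv

theorem inv_sqrt_mul_mul_inv_sqrt {G : Matrix ι ι ℂ} (hG : G.PosDef) :
    (CFC.sqrt G)⁻¹ * G * (CFC.sqrt G)⁻¹ = 1 := by
  have hRR : CFC.sqrt G * CFC.sqrt G = G := CFC.sqrt_mul_sqrt_self G hG.posSemidef.nonneg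
  have hRu := isUnit_det_sqrt hG
  nth_rewrite 2 [← hRR]
  rw [← mul_assoc, Matrix.nonsing_inv_mul _ hRu, one_mul, Matrix.mul_nonsing_inv _ hRu]

/-- The Hayashi–Nagaoka operator inequality for a projection `S`; here `W = (S + T) ^ (-1/2)`. -/
theorem hayashi_nagaoka {S T : Matrix ι ι ℂ} (hS : S.PosSemidef) (hSS : S * S = S)
    (hT : T.PosSemidef) {G : Matrix ι ι ℂ} (hG : G.PosDef) (hST : G = S + T) {W : Matrix ι ι ℂ}
    (hW : W = (CFC.sqrt G)⁻¹) :
    1 - W * S * W ≤ (2 : ℂ) • (1 - S) + (4 : ℂ) • T := by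
  obtain ⟨R, hR⟩ : ∃ R, R = CFC.sqrt G := ⟨_, rfl⟩
  rw [← hR] at hW
  have hGS : S ≤ G := Matrix.le_iff.2 (by rw [hST, add_sub_cancel_left]; exact hT)
  have hSR : (R - S).PosSemidef := by
    rw [hR]; exact Matrix.le_iff.1 (le_sqrt_of_mul_self_eq hS hSS hGS)
  have hRR : R * R = G := by rw [hR]; exact CFC.sqrt_mul_sqrt_self G hG.posSemidef.nonneg
  have hRu : IsUnit R.det := by rw [hR]; exact isUnit_det_sqrt hG
  have hWR : W * R = 1 := by rw [hW]; exact Matrix.nonsing_inv_mul R hRu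
  have hRW : R * W = 1 := by rw [hW]; exact Matrix.mul_nonsing_inv R hRu
  have hWh : W.IsHermitian := by rw [hW, hR]; exact isHermitian_inv_sqrt G
  have hTe : T = R * R - S := by rw [hRR, hST, add_sub_cancel_left]
  have hW1 : (W - 1).IsHermitian := hWh.sub Matrix.isHermitian_one
  have hW2 : (W - 2).IsHermitian := hWh.sub (by
    rw [show (2 : Matrix ι ι ℂ) = 1 + 1 by norm_num]
    exact Matrix.isHermitian_one.add Matrix.isHermitian_one)
  have p1 := hT.mul_mul_conjTranspose_same (W - 2)
  have p2 := hS.mul_mul_conjTranspose_same (W - 1)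
  rw [hW2.eq] at p1
  rw [hW1.eq] at p2
  -- An explicit certificate: with R = √G and T = R² - S, the difference of the two sides is
  -- (W-2)T(W-2) + 2(W-1)S(W-1) + 4(R-S), a sum of positive operators.
  have key : (2 : ℂ) • (1 - S) + (4 : ℂ) • T - (1 - W * S * W) =
      (W - 2) * T * (W - 2) + ((W - 1) * S * (W - 1) + (W - 1) * S * (W - 1)) +
        ((R - S) + (R - S) + (R - S) + (R - S)) := by
    have e1 : W * (R * R) = R := by rw [← mul_assoc, hWR, one_mul]
    have e2 : R * R * W = R := by rw [mul_assoc, hRW, mul_one]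
    have e3 : (W - 2) * T * (W - 2) = 1 - W * S * W - 2 * R + 2 * (W * S) - 2 * R + 2 * (S * W)
        + 4 * (R * R) - 4 * S := by
      rw [hTe]
      calc (W - 2) * (R * R - S) * (W - 2)
          = (W * (R * R)) * W - W * S * W - 2 * (W * (R * R)) + 2 * (W * S) - 2 * (R * R * W)
            + 2 * (S * W) + 4 * (R * R) - 4 * S := by noncomm_ring
        _ = _ := by rw [e1, e2, hRW]
    rw [e3, hTe]
    have c2 : ∀ X : Matrix ι ι ℂ, (2 : ℂ) • X = X + X := fun X => two_smul ℂ X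
    have c4 : ∀ X : Matrix ι ι ℂ, (4 : ℂ) • X = X + X + X + X := fun X => by
      rw [show (4 : ℂ) = 2 + 2 by norm_num, add_smul, two_smul]; abel
    rw [c2, c4]
    noncomm_ring
  rw [Matrix.le_iff, key]
  exact (p1.add (p2.add p2)).add (((hSR.add hSR).add hSR).add hSR)

end HayashiNagaoka
end MatrixInequalities

/-! ### Channels on one half of a bipartite system -/

section Channels

variable {ι κ μ β : Type*}

theorem applyLeft_comp (Φ : Matrix κ κ ℂ →ₗ[ℂ] Matrix μ μ ℂ) (Ψ : Matrix ι ι ℂ →ₗ[ℂ] Matrix κ κ ℂ)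
    (X : Matrix (ι × β) (ι × β) ℂ) :
    applyLeft (Φ ∘ₗ Ψ) X = applyLeft Φ (applyLeft Ψ X) := rfl

variable [Fintype ι] [Fintype κ] [Fintype μ]

theorem IsCPTP.comp {Φ : Matrix κ κ ℂ →ₗ[ℂ] Matrix μ μ ℂ} {Ψ : Matrix ι ι ℂ →ₗ[ℂ] Matrix κ κ ℂ}
    (hΦ : IsCPTP Φ) (hΨ : IsCPTP Ψ) : IsCPTP (Φ ∘ₗ Ψ) where
  completelyPositive k X hX := by
    rw [applyLeft_comp]
    exact hΦ.completelyPositive k _ (hΨ.completelyPositive k X hX)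
  tracePreserving X := by
    rw [LinearMap.comp_apply, hΦ.tracePreserving, hΨ.tracePreserving]

theorem IsCPTP.id : IsCPTP (LinearMap.id : Matrix ι ι ℂ →ₗ[ℂ] Matrix ι ι ℂ) where
  completelyPositive _ _ hX := hX
  tracePreserving _ := rfl

/-- Complete positivity is only tested on ancillas `Fin k`; enumerating `β` transfers it to any
finite ancilla. -/
theorem IsCPTP.posSemidef_applyLeft [Fintype β] {Φ : Matrix ι ι ℂ →ₗ[ℂ] Matrix κ κ ℂ}
    (hΦ : IsCPTP Φ) {X : Matrix (ι × β) (ι × β) ℂ} (hX : X.PosSemidef) :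
    (applyLeft Φ X).PosSemidef := by
  have e := Fintype.equivFin β
  have h := (hΦ.completelyPositive _ _ (hX.submatrix (Prod.map (_root_.id : ι → ι) e.symm))).submatrix
    (Prod.map (_root_.id : κ → κ) e)
  convert h using 1
  ext p q
  simp [applyLeft]

/-- No signalling from Alice to Bob: each block of the operator keeps its trace. -/
theorem IsCPTP.reducedRight_applyLeft {Φ : Matrix ι ι ℂ →ₗ[ℂ] Matrix κ κ ℂ}
    (hΦ : IsCPTP Φ) (X : Matrix (ι × β) (ι × β) ℂ) :
    reducedRight (applyLeft Φ X) = reducedRight X := by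
  ext b b'
  exact hΦ.tracePreserving (Matrix.of fun i j => X (i, b) (j, b'))

theorem trace_reducedRight [Fintype β] (X : Matrix (ι × β) (ι × β) ℂ) :
    (reducedRight X).trace = X.trace := by
  simp only [Matrix.trace, reducedRight, Matrix.diag_apply, Matrix.of_apply, Fintype.sum_prod_type]
  exact Finset.sum_comm

theorem posSemidef_reducedRight [Fintype β] {X : Matrix (ι × β) (ι × β) ℂ} (hX : X.PosSemidef) :
    (reducedRight X).PosSemidef := by
  have h : reducedRight X = ∑ a, X.submatrix (fun b => (a, b)) (fun b => (a, b)) := by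
    ext b b'
    simp [reducedRight, Matrix.sum_apply]
  rw [h]
  exact Matrix.posSemidef_sum _ fun a _ => hX.submatrix _

theorem IsCPTP.isState_applyLeft [Fintype β] {Φ : Matrix ι ι ℂ →ₗ[ℂ] Matrix κ κ ℂ}
    (hΦ : IsCPTP Φ) {X : Matrix (ι × β) (ι × β) ℂ} (hX : IsState X) : IsState (applyLeft Φ X) where
  posSemidef := hΦ.posSemidef_applyLeft hX.posSemidef
  trace_eq_one := by
    rw [← trace_reducedRight, hΦ.reducedRight_applyLeft, trace_reducedRight, hX.trace_eq_one]

/-- Conjugation `X ↦ U X Uᴴ`. -/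
def conjMap (U : Matrix ι ι ℂ) : Matrix ι ι ℂ →ₗ[ℂ] Matrix ι ι ℂ :=
  LinearMap.mulRight ℂ U.conjTranspose ∘ₗ LinearMap.mulLeft ℂ U

theorem conjMap_apply (U X : Matrix ι ι ℂ) : conjMap U X = U * X * U.conjTranspose := rfl

theorem applyLeft_conjMap [Fintype β] [DecidableEq β] (U : Matrix ι ι ℂ)
    (X : Matrix (ι × β) (ι × β) ℂ) :
    applyLeft (conjMap U) X =
      (U ⊗ₖ (1 : Matrix β β ℂ)) * X * (U ⊗ₖ (1 : Matrix β β ℂ)).conjTranspose := by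
  ext ⟨i, b⟩ ⟨j, b'⟩
  simp [applyLeft, conjMap_apply, Matrix.mul_apply, Fintype.sum_prod_type, Matrix.one_apply,
    Finset.sum_mul, apply_ite (starRingEnd ℂ)]

theorem isCPTP_conjMap [DecidableEq ι] {U : Matrix ι ι ℂ} (hU : U.conjTranspose * U = 1) :
    IsCPTP (conjMap U) where
  completelyPositive k X hX := by
    rw [applyLeft_conjMap]
    exact hX.mul_mul_conjTranspose_same _
  tracePreserving X := by
    rw [conjMap_apply, Matrix.trace_mul_comm, ← mul_assoc, hU, one_mul]

end Channels

/-! ### Weyl operators and the completely depolarizing channel -/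

section Twirling

/-- The discrete Weyl operator `e_x ↦ χ (x + k) e_{x + k}`. -/
def weylOp {α : Type*} [AddCommGroup α] [DecidableEq α] (g : α × AddChar α ℂ) : Matrix α α ℂ :=
  Matrix.of fun x y => if y = x - g.1 then g.2 x else 0

theorem weylOp_conjTranspose_mul_self {α : Type*} [AddCommGroup α] [DecidableEq α] [Fintype α]
    (g : α × AddChar α ℂ) : (weylOp g).conjTranspose * weylOp g = 1 := by
  rw [_root_.mul_eq_one_comm]
  ext x y
  simp only [weylOp, Matrix.mul_apply, Matrix.conjTranspose_apply, Matrix.of_apply, ite_mul,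
    zero_mul, Finset.sum_ite_eq', Finset.mem_univ, if_true, sub_left_inj, Matrix.one_apply]
  by_cases h : x = y
  · subst h
    simp [Complex.mul_conj, Complex.normSq_eq_norm_sq, AddChar.norm_apply]
  · simp [h]

/-- Summing over characters kills the off-diagonal entries by orthogonality; summing over shifts
replaces each diagonal entry by the trace. -/
theorem sum_weylOp_conj {α : Type*} [AddCommGroup α] [DecidableEq α] [Fintype α]
    (X : Matrix α α ℂ) :
    ∑ g : α × AddChar α ℂ, weylOp g * X * (weylOp g).conjTranspose =
      ((Fintype.card α : ℂ) * X.trace) • (1 : Matrix α α ℂ) := by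
  ext x y
  have h : ∀ g : α × AddChar α ℂ, (weylOp g * X * (weylOp g).conjTranspose) x y =
      g.2 (x - y) * X (x - g.1) (y - g.1) := by
    intro g
    have : g.2 (x - y) = g.2 x * star (g.2 y) := by
      rw [sub_eq_add_neg, AddChar.map_add_eq_mul, AddChar.map_neg_eq_conj]; rfl
    simp only [weylOp, Matrix.mul_apply, Matrix.conjTranspose_apply, Matrix.of_apply, ite_mul,
      zero_mul, Finset.sum_ite_eq', Finset.mem_univ, if_true, apply_ite star, star_zero, mul_ite,
      mul_zero, this]
    ring
  simp only [Matrix.sum_apply, h, Fintype.sum_prod_type, ← Finset.sum_mul,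
    AddChar.sum_apply_eq_ite]
  by_cases hxy : x = y
  · subst hxy
    simp only [sub_self, if_true, ← Finset.mul_sum, Matrix.smul_apply, Matrix.one_apply_eq,
      smul_eq_mul, mul_one, Matrix.trace, Matrix.diag_apply]
    congr 1
    exact (Equiv.subLeft x).sum_comp fun z => X z z
  · simp [sub_eq_zero, hxy]

/-- Finitely many unitaries, among them the identity, whose uniform mixture is the completely
depolarizing channel. -/
theorem exists_unitary_twirl.{u} (α : Type u) [Fintype α] [DecidableEq α] [Nonempty α] :
    ∃ (G : Type u) (_ : Fintype G) (U : G → Matrix α α ℂ),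
      (∀ g, (U g).conjTranspose * U g = 1) ∧ (∃ g, U g = 1) ∧
      Fintype.card G = Fintype.card α ^ 2 ∧
      ∀ X : Matrix α α ℂ, ∑ g, conjMap (U g) X = ((Fintype.card α : ℂ) * X.trace) • 1 := by
  have : NeZero (Fintype.card α) := ⟨Fintype.card_ne_zero⟩
  -- Any group structure will do; the cyclic one is transported from `Fin`.
  let _ : AddCommGroup α := (Fintype.equivFin α).addCommGroup
  refine ⟨α × AddChar α ℂ, inferInstance, weylOp, weylOp_conjTranspose_mul_self, ⟨0, ?_⟩, ?_,
    sum_weylOp_conj⟩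
  · ext x y
    simp [weylOp, Matrix.one_apply, eq_comm]
  · rw [Fintype.card_prod, AddChar.card_eq, sq]

theorem sum_applyLeft_conjMap {α β G : Type*} [Fintype α] [DecidableEq α] [Fintype G]
    {U : G → Matrix α α ℂ}
    (hU : ∀ X : Matrix α α ℂ, ∑ g, conjMap (U g) X = ((Fintype.card α : ℂ) * X.trace) • 1)
    (X : Matrix (α × β) (α × β) ℂ) :
    ∑ g, applyLeft (conjMap (U g)) X =
      (Fintype.card α : ℂ) • ((1 : Matrix α α ℂ) ⊗ₖ reducedRight X) := by
  ext p q
  have h := congrFun (congrFun (hU (Matrix.of fun i j => X (i, p.2) (j, q.2))) p.1) q.1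
  rw [Matrix.sum_apply] at h ⊢
  refine h.trans ?_
  simp [Matrix.trace, reducedRight, Matrix.kroneckerMap_apply, mul_comm, mul_left_comm]

open scoped MatrixOrder in
/-- The bound `X ≤ dim A • (1 ⊗ Tr_A X)` for positive bipartite operators. -/
theorem le_card_smul_one_kronecker_reducedRight {α β : Type*} [Fintype α] [DecidableEq α]
    [Nonempty α] [Fintype β] [DecidableEq β] {X : Matrix (α × β) (α × β) ℂ} (hX : X.PosSemidef) :
    X ≤ (Fintype.card α : ℂ) • ((1 : Matrix α α ℂ) ⊗ₖ reducedRight X) := by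
  -- The right-hand side is a sum of positive operators, one of which, for U = 1, is X itself.
  obtain ⟨G, _, U, hU, ⟨g, hg⟩, -, hsum⟩ := exists_unitary_twirl α
  rw [← sum_applyLeft_conjMap hsum X]
  have h : applyLeft (conjMap (U g)) X = X := by
    rw [applyLeft_conjMap, hg]
    simp
  calc X = applyLeft (conjMap (U g)) X := h.symm
    _ ≤ _ := Finset.single_le_sum (f := fun g => applyLeft (conjMap (U g)) X)
      (fun k _ => ((isCPTP_conjMap (hU k)).posSemidef_applyLeft hX).nonneg) (Finset.mem_univ g)

end Twirling

/-! ### The square-root measurement -/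

section Decoding

open scoped MatrixOrder

variable {ι : Type*} [Fintype ι] [DecidableEq ι]

/-- The square-root measurement built from projections `T i`, with its error estimate. -/
theorem exists_decoder {J : Type*} [Fintype J] [DecidableEq J] {T τ : J → Matrix ι ι ℂ}
    (hT : ∀ i, (T i).PosSemidef) (hTT : ∀ i, T i * T i = T i) (hτ : ∀ i, IsState (τ i))
    {δ : ℝ} (hδ : 0 < δ) :
    ∃ E : J → Matrix ι ι ℂ, (∀ i, (E i).PosSemidef) ∧ (1 - ∑ i, E i).PosSemidef ∧
      ∀ i, 1 - (τ i * E i).trace.re ≤ 2 * (1 - (τ i * T i).trace.re) +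
        4 * ∑ j ∈ Finset.univ.erase i, (τ i * T j).trace.re + 4 * δ := by
  -- Adding δ makes ∑ T j invertible, so that W is a genuine inverse square root; the price is the
  -- term 4δ, and the slack 1 - ∑ E i is δ W².
  have hδ1 : ((δ : ℂ) • (1 : Matrix ι ι ℂ)).PosDef :=
    Matrix.PosDef.one.smul (by exact_mod_cast hδ)
  have hsum : ∀ s : Finset J, (∑ j ∈ s, T j).PosSemidef :=
    fun s => Matrix.posSemidef_sum _ fun j _ => hT j
  obtain ⟨G, hGe⟩ : ∃ G, G = ∑ j, T j + (δ : ℂ) • (1 : Matrix ι ι ℂ) := ⟨_, rfl⟩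
  have hG : G.PosDef := by rw [hGe]; exact Matrix.PosDef.posSemidef_add (hsum _) hδ1
  obtain ⟨W, hW⟩ : ∃ W, W = (CFC.sqrt G)⁻¹ := ⟨_, rfl⟩
  have hWh := isHermitian_inv_sqrt G
  have hWG := inv_sqrt_mul_mul_inv_sqrt hG
  rw [← hW] at hWh hWG
  refine ⟨fun i => W * T i * W, fun i => ?_, ?_, fun i => ?_⟩
  · have h := (hT i).mul_mul_conjTranspose_same W
    rwa [hWh.eq] at h
  · have h := hδ1.posSemidef.mul_mul_conjTranspose_same W
    rw [hWh.eq] at h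
    rw [hGe, mul_add, add_mul] at hWG
    rwa [← Finset.sum_mul, ← Finset.mul_sum, ← hWG, add_sub_cancel_left]
  · have hS : G = T i + (∑ j ∈ Finset.univ.erase i, T j + (δ : ℂ) • (1 : Matrix ι ι ℂ)) := by
      rw [hGe, ← Finset.add_sum_erase _ _ (Finset.mem_univ i), add_assoc]
    have h := re_trace_mul_le_of_le (hayashi_nagaoka (hT i) (hTT i)
      ((hsum (Finset.univ.erase i)).add hδ1.posSemidef) hG hS hW) (hτ i).posSemidef
    rw [Matrix.trace_mul_comm, Matrix.trace_mul_comm _ (τ i)] at h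
    have h1 := (hτ i).trace_eq_one
    simp only [mul_sub, mul_add, Matrix.mul_smul, Matrix.trace_sub, Matrix.trace_add,
      Matrix.trace_smul, mul_one, h1, Finset.mul_sum, Matrix.trace_sum, Complex.sub_re,
      Complex.add_re, Complex.re_sum, smul_eq_mul, Complex.one_re, Complex.mul_re,
      Complex.ofReal_re, Complex.ofReal_im, Complex.re_ofNat, Complex.im_ofNat, zero_mul,
      sub_zero, mul_zero] at h ⊢
    linarith

end Decoding

/-! ### Random coding -/

section RandomCoding

/-- Pairwise independence of a uniformly random codebook: with all coordinates but `i` frozen, only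
the first argument of F varies. -/
theorem sum_pairwise_comp {G : Type*} [Fintype G] {J : Type*} [Fintype J] [DecidableEq J]
    {F : G → G → ℝ} {q : ℝ} (hF : ∀ h, ∑ g, F g h = Fintype.card G * q) {i j : J} (hij : j ≠ i) :
    ∑ c : J → G, F (c i) (c j) = Fintype.card (J → G) * q := by
  rw [← (Equiv.funSplitAt i G).symm.sum_comp, Fintype.sum_prod_type_right,
    Fintype.card_congr (Equiv.funSplitAt i G), Fintype.card_prod]
  have h : ∀ c : {k // k ≠ i} → G, ∑ g, F ((Equiv.funSplitAt i G).symm (g, c) i)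
      ((Equiv.funSplitAt i G).symm (g, c) j) = Fintype.card G * q := by
    intro c
    rw [← hF (c ⟨j, hij⟩)]
    simp [Equiv.funSplitAt, Equiv.piSplitAt, hij]
  rw [Finset.sum_congr rfl fun c _ => h c]
  simp
  ring

/-- The random coding argument: some assignment `c` does at least as well as the average. -/
theorem exists_assignment {G : Type*} [Fintype G] [Nonempty G] {J : Type*} [Fintype J]
    [DecidableEq J] {F : G → G → ℝ} {q : ℝ}
    (hF : ∀ h, ∑ g, F g h = Fintype.card G * q) :
    ∃ c : J → G, ∑ i, ∑ j ∈ Finset.univ.erase i, F (c i) (c j) ≤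
      (Fintype.card J : ℝ) * ((Fintype.card J - 1) * q) := by
  have h : ∑ c : J → G, ∑ i, ∑ j ∈ Finset.univ.erase i, F (c i) (c j) ≤
      ∑ _c : J → G, (Fintype.card J : ℝ) * ((Fintype.card J - 1) * q) := by
    rw [Finset.sum_comm]
    have h1 : ∀ i : J, ∑ c : J → G, ∑ j ∈ Finset.univ.erase i, F (c i) (c j) ≤
        (Fintype.card J - 1) * (Fintype.card (J → G) * q) := by
      intro i
      rw [Finset.sum_comm, Finset.sum_congr rfl fun j hj =>
        sum_pairwise_comp hF (Finset.ne_of_mem_erase hj), Finset.sum_const, nsmul_eq_mul,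
        Finset.card_erase_of_mem (Finset.mem_univ i), Finset.card_univ,
        Nat.cast_pred (Fintype.card_pos_iff.2 ⟨i⟩)]
    refine (Finset.sum_le_sum fun i _ => h1 i).trans (le_of_eq ?_)
    rw [Finset.sum_const, Finset.sum_const, nsmul_eq_mul, nsmul_eq_mul, Finset.card_univ,
      Finset.card_univ]
    ring
  obtain ⟨c, -, hc⟩ := Finset.exists_le_of_sum_le Finset.univ_nonempty h
  exact ⟨c, hc⟩

variable {α β : Type*} [Fintype α] [DecidableEq α] [Fintype β] [DecidableEq β]

/-- One-shot dense coding: twirling the state `(Λ ⊗ id) ρ` by random Weyl operators. -/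
theorem exists_denseCode [Nonempty α] {ρ T : Matrix (α × β) (α × β) ℂ} (hρ : IsState ρ)
    {Λ : Matrix α α ℂ →ₗ[ℂ] Matrix α α ℂ} (hΛ : IsCPTP Λ) (hT : T.PosSemidef) (hTT : T * T = T)
    {M : ℕ} (hM : 0 < M) {δ : ℝ} (hδ : 0 < δ) :
    ∃ C : DenseCode α β M, C.error ρ ≤ 2 * (1 - (applyLeft Λ ρ * T).trace.re) +
      4 * ((M - 1) * ((((1 : Matrix α α ℂ) ⊗ₖ reducedRight ρ) * T).trace.re / Fintype.card α)) +
      4 * δ := by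
  obtain ⟨G, _, U, hU, ⟨g₀, -⟩, hcard, hsum⟩ := exists_unitary_twirl α
  have hG : Nonempty G := ⟨g₀⟩
  set σ := applyLeft Λ ρ with hσ
  have hσs : IsState σ := hΛ.isState_applyLeft hρ
  have hσB : reducedRight σ = reducedRight ρ := hΛ.reducedRight_applyLeft ρ
  set Q := (1 : Matrix α α ℂ) ⊗ₖ reducedRight ρ with hQ
  let V : G → Matrix (α × β) (α × β) ℂ := fun g => U g ⊗ₖ (1 : Matrix β β ℂ)
  have hV : ∀ g, (V g).conjTranspose * V g = 1 := fun g => by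
    simp only [V, Matrix.conjTranspose_kronecker, Matrix.conjTranspose_one,
      ← Matrix.mul_kronecker_mul, hU, mul_one, Matrix.one_kronecker_one]
  let S : G → Matrix (α × β) (α × β) ℂ := fun g => applyLeft (conjMap (U g)) σ
  let P : G → Matrix (α × β) (α × β) ℂ := fun g => V g * T * (V g).conjTranspose
  have hS : ∀ g, S g = V g * σ * (V g).conjTranspose := fun g => applyLeft_conjMap _ _
  have hP : ∀ g, (P g).PosSemidef := fun g => hT.mul_mul_conjTranspose_same _
  have hPP : ∀ g, P g * P g = P g := fun g => by
    calc P g * P g = V g * T * ((V g).conjTranspose * V g) * T * (V g).conjTranspose := by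
          simp only [P, mul_assoc]
      _ = V g * (T * T) * (V g).conjTranspose := by rw [hV]; simp only [mul_one, mul_assoc]
      _ = P g := by rw [hTT]
  have hSP : ∀ g, (S g * P g).trace = (σ * T).trace := fun g => by
    have : S g * P g = V g * (σ * T * (V g).conjTranspose) := by
      calc S g * P g = V g * σ * ((V g).conjTranspose * V g) * T * (V g).conjTranspose := by
            simp only [hS, P, mul_assoc]
        _ = _ := by rw [hV]; simp only [mul_one, mul_assoc]
    rw [this, Matrix.trace_mul_comm, mul_assoc, hV, mul_one]
  -- Q is the identity on Alice's side, hence invariant under her unitaries.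
  have hQP : ∀ g, (Q * P g).trace = (Q * T).trace := fun g => by
    have h1 : (V g).conjTranspose * Q * V g = Q := by
      simp only [V, hQ, Matrix.conjTranspose_kronecker, Matrix.conjTranspose_one,
        ← Matrix.mul_kronecker_mul, hU, mul_one, one_mul]
    calc (Q * P g).trace = ((Q * V g * T) * (V g).conjTranspose).trace := by
          simp only [P, mul_assoc]
      _ = ((V g).conjTranspose * Q * V g * T).trace := by
          rw [Matrix.trace_mul_comm]; simp only [mul_assoc]
      _ = _ := by rw [h1]
  have hD : (0 : ℝ) < Fintype.card α := by exact_mod_cast Fintype.card_pos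
  -- The twirl sums to dim A • Q, and |G| = (dim A)², whence the quotient by dim A in the average.
  have hF : ∀ h, ∑ g, (S g * P h).trace.re =
      Fintype.card G * ((Q * T).trace.re / Fintype.card α) := by
    intro h
    rw [← Complex.re_sum, ← Matrix.trace_sum, ← Finset.sum_mul, sum_applyLeft_conjMap hsum σ,
      hσB, ← hQ, Matrix.smul_mul, Matrix.trace_smul, hQP, hcard, smul_eq_mul,
      ← Complex.ofReal_natCast, Complex.re_ofReal_mul]
    push_cast
    field_simp
  obtain ⟨c, hc⟩ := exists_assignment (J := Fin M) (F := fun g h => (S g * P h).trace.re) hF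
  obtain ⟨E, hE, hE1, herr⟩ := exists_decoder (T := fun i => P (c i)) (τ := fun i => S (c i))
    (fun i => hP _) (fun i => hPP _) (fun i => (isCPTP_conjMap (hU _)).isState_applyLeft hσs) hδ
  refine ⟨⟨fun i => conjMap (U (c i)) ∘ₗ Λ, fun i => (isCPTP_conjMap (hU _)).comp hΛ, E, hE, hE1⟩,
    ?_⟩
  have hM' : (0 : ℝ) < M := by exact_mod_cast hM
  simp only [hSP] at herr
  rw [Fintype.card_fin] at hc
  have h := Finset.sum_le_sum fun i (_ : i ∈ Finset.univ) => herr i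
  rw [Finset.sum_add_distrib, Finset.sum_add_distrib, ← Finset.mul_sum, ← Finset.mul_sum] at h
  simp only [Finset.sum_const, Finset.card_univ, Fintype.card_fin, nsmul_eq_mul] at h
  rw [DenseCode.error, one_div, inv_mul_le_iff₀ hM']
  refine h.trans ?_
  nlinarith [hc]

end RandomCoding

/-! ### The optimal test value and its bounds -/

section TestValue

open scoped MatrixOrder

variable {α β : Type*} [Fintype α] [DecidableEq α] [Fintype β] {σ : Matrix (α × β) (α × β) ℂ}

theorem posSemidef_one_kronecker_reducedRight (hσ : σ.PosSemidef) :
    ((1 : Matrix α α ℂ) ⊗ₖ reducedRight σ).PosSemidef :=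
  Matrix.PosSemidef.one.kronecker (posSemidef_reducedRight hσ)

theorem trace_one_kronecker_reducedRight (hσ : IsState σ) :
    ((1 : Matrix α α ℂ) ⊗ₖ reducedRight σ).trace = (Fintype.card α : ℂ) := by
  rw [Matrix.trace_kronecker, trace_reducedRight, hσ.trace_eq_one, Matrix.trace_one, mul_one]

theorem re_trace_mul_sub_smul {ι : Type*} [Fintype ι] {σ : Matrix ι ι ℂ} (T : Matrix ι ι ℂ)
    (c : ℝ) (ω : Matrix ι ι ℂ) :
    (T * (σ - (c : ℂ) • ω)).trace.re = (T * σ).trace.re - c * (T * ω).trace.re := by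
  rw [mul_sub, Matrix.trace_sub, Complex.sub_re, Matrix.mul_smul, Matrix.trace_smul, smul_eq_mul,
    Complex.re_ofReal_mul]

theorem isHermitian_sub_smul_one_kronecker (hσ : σ.PosSemidef) (c : ℝ) :
    (σ - (c : ℂ) • ((1 : Matrix α α ℂ) ⊗ₖ reducedRight σ)).IsHermitian := by
  refine hσ.isHermitian.sub ?_
  have h := (posSemidef_one_kronecker_reducedRight hσ).isHermitian
  rw [Matrix.IsHermitian, Matrix.conjTranspose_smul, h.eq]
  simp

variable [DecidableEq β]

/-- The optimal value `Tr[{Π ≥ 0} Π]` for `Π = σ - c • (1 ⊗ Tr_A σ)`. -/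
noncomputable def testValue (σ : Matrix (α × β) (α × β) ℂ) (c : ℝ) : ℝ :=
  (nonnegProj (σ - (c : ℂ) • ((1 : Matrix α α ℂ) ⊗ₖ reducedRight σ)) *
    (σ - (c : ℂ) • ((1 : Matrix α α ℂ) ⊗ₖ reducedRight σ))).trace.re

theorem le_testValue (hσ : σ.PosSemidef) {T : Matrix (α × β) (α × β) ℂ} (hT : T.PosSemidef)
    (hT1 : (1 - T).PosSemidef) (c : ℝ) :
    (T * σ).trace.re - c * (T * ((1 : Matrix α α ℂ) ⊗ₖ reducedRight σ)).trace.re ≤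
      testValue σ c := by
  rw [← re_trace_mul_sub_smul]
  exact re_trace_mul_le_nonnegProj (isHermitian_sub_smul_one_kronecker hσ c) hT hT1

theorem re_trace_test_mul_le_one (hσ : IsState σ) {T : Matrix (α × β) (α × β) ℂ}
    (hT1 : (1 - T).PosSemidef) : (T * σ).trace.re ≤ 1 := by
  have h := re_trace_mul_le_of_le (Matrix.le_iff.2 hT1) hσ.posSemidef
  rwa [one_mul, hσ.trace_eq_one, Complex.one_re] at h

/-- The optimal test: a projection that attains `testValue σ c`. -/
theorem exists_optimal_test (hσ : IsState σ) {c : ℝ} (hc : 0 ≤ c) :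
    ∃ T : Matrix (α × β) (α × β) ℂ, T.PosSemidef ∧ (1 - T).PosSemidef ∧ T * T = T ∧
      testValue σ c =
        (T * σ).trace.re - c * (T * ((1 : Matrix α α ℂ) ⊗ₖ reducedRight σ)).trace.re ∧
      testValue σ c ≤ (T * σ).trace.re ∧
      c * (T * ((1 : Matrix α α ℂ) ⊗ₖ reducedRight σ)).trace.re ≤ 1 - testValue σ c := by
  have h0 := nonnegProj_posSemidef (σ - (c : ℂ) • ((1 : Matrix α α ℂ) ⊗ₖ reducedRight σ))
  have h1 := one_sub_nonnegProj_posSemidef (σ - (c : ℂ) • ((1 : Matrix α α ℂ) ⊗ₖ reducedRight σ))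
  have h2 := re_trace_mul_sub_smul (σ := σ)
    (nonnegProj (σ - (c : ℂ) • ((1 : Matrix α α ℂ) ⊗ₖ reducedRight σ))) c
    ((1 : Matrix α α ℂ) ⊗ₖ reducedRight σ)
  have h3 := mul_nonneg hc
    (h0.re_trace_mul_nonneg (posSemidef_one_kronecker_reducedRight hσ.posSemidef))
  have h4 := re_trace_test_mul_le_one hσ h1
  refine ⟨_, h0, h1, nonnegProj_mul_self _, h2, ?_, ?_⟩ <;> unfold testValue <;> linarith

theorem testValue_le_one (hσ : IsState σ) {c : ℝ} (hc : 0 ≤ c) : testValue σ c ≤ 1 := by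
  obtain ⟨T, -, h1, -, -, h, -⟩ := exists_optimal_test hσ hc
  exact h.trans (re_trace_test_mul_le_one hσ h1)

/-- The optimal test for the larger constant does at least as well with the smaller one. -/
theorem testValue_anti (hσ : IsState σ) {c c' : ℝ} (hc' : 0 ≤ c') (h : c ≤ c') :
    testValue σ c' ≤ testValue σ c := by
  obtain ⟨T, h0, h1, -, h2, -, -⟩ := exists_optimal_test hσ hc'
  have h3 := le_testValue hσ.posSemidef h0 h1 c
  have h4 := mul_le_mul_of_nonneg_right h
    (h0.re_trace_mul_nonneg (posSemidef_one_kronecker_reducedRight hσ.posSemidef))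
  linarith

/-- The trivial test T = 1. -/
theorem one_sub_mul_card_le_testValue (hσ : IsState σ) (c : ℝ) :
    1 - c * Fintype.card α ≤ testValue σ c := by
  have h := le_testValue hσ.posSemidef Matrix.PosSemidef.one
    (by rw [sub_self]; exact Matrix.PosSemidef.zero) c
  rwa [one_mul, one_mul, trace_one_kronecker_reducedRight hσ, hσ.trace_eq_one, Complex.one_re,
    Complex.natCast_re] at h

theorem testValue_nonpos [Nonempty α] (hσ : IsState σ) {c : ℝ} (hc : (Fintype.card α : ℝ) ≤ c) :
    testValue σ c ≤ 0 := by
  obtain ⟨T, h0, h1, -, h2, -, -⟩ :=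
    exists_optimal_test hσ ((Nat.cast_nonneg (Fintype.card α)).trans hc)
  have h3 := re_trace_mul_le_of_le (le_card_smul_one_kronecker_reducedRight hσ.posSemidef) h0
  rw [Matrix.trace_mul_comm, Matrix.smul_mul, Matrix.trace_smul, smul_eq_mul,
    ← Complex.ofReal_natCast, Complex.re_ofReal_mul, Matrix.trace_mul_comm _ T] at h3
  have h4 := mul_le_mul_of_nonneg_right hc
    (h0.re_trace_mul_nonneg (posSemidef_one_kronecker_reducedRight hσ.posSemidef))
  linarith

end TestValue

/-! ### One-shot direct and converse bounds -/

section OneShot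

open scoped MatrixOrder

variable {α β : Type*} [Fintype α] [DecidableEq α] [Fintype β] [DecidableEq β]
  {ρ : Matrix (α × β) (α × β) ℂ}

/-- The optimal projection controls both error terms: since its value is v, it accepts σ with
probability at least v, and c Tr[TQ] ≤ 1 - v. -/
theorem exists_denseCode_error_le [Nonempty α] (hρ : IsState ρ)
    {Λ : Matrix α α ℂ →ₗ[ℂ] Matrix α α ℂ} (hΛ : IsCPTP Λ) {M : ℕ} (hM : 0 < M) {c : ℝ} (hc : 0 < c)
    {δ : ℝ} (hδ : 0 < δ) :
    ∃ C : DenseCode α β M, C.error ρ ≤ 2 * (1 - testValue (applyLeft Λ ρ) c) +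
      4 * ((M - 1) * ((1 - testValue (applyLeft Λ ρ) c) / c / Fintype.card α)) + 4 * δ := by
  obtain ⟨T, h0, -, hTT, -, h3, h4⟩ := exists_optimal_test (hΛ.isState_applyLeft hρ) hc.le
  obtain ⟨C, hC⟩ := exists_denseCode hρ hΛ h0 hTT hM hδ
  refine ⟨C, hC.trans ?_⟩
  rw [hΛ.reducedRight_applyLeft, Matrix.trace_mul_comm, mul_comm c, ← le_div_iff₀ hc] at h4
  rw [Matrix.trace_mul_comm] at h3
  have hM1 : (0 : ℝ) ≤ M - 1 := sub_nonneg.2 (by exact_mod_cast hM)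
  gcongr

theorem DenseCode.one_sub_dec_posSemidef {M : ℕ} (C : DenseCode α β M) (i : Fin M) :
    (1 - C.dec i).PosSemidef := by
  have h : C.dec i ≤ ∑ i, C.dec i := Finset.single_le_sum (f := C.dec)
    (fun k _ => (C.dec_posSemidef k).nonneg) (Finset.mem_univ i)
  exact Matrix.le_iff.1 (h.trans (Matrix.le_iff.2 C.dec_sum_le_one))

theorem DenseCode.error_nonneg {M : ℕ} (C : DenseCode α β M) (hρ : IsState ρ) :
    0 ≤ C.error ρ := by
  refine mul_nonneg (by positivity) (Finset.sum_nonneg fun i _ => ?_)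
  have h := re_trace_test_mul_le_one ((C.enc_isCPTP i).isState_applyLeft hρ)
    (C.one_sub_dec_posSemidef i)
  rw [Matrix.trace_mul_comm] at h
  linarith

/-- Converse: one of the encoders of a good code makes `testValue` large. -/
theorem DenseCode.exists_le_testValue {M : ℕ} (hM : 0 < M) (C : DenseCode α β M) (hρ : IsState ρ)
    {c : ℝ} (hc : 0 ≤ c) :
    ∃ i, 1 - C.error ρ - c * Fintype.card α / M ≤ testValue (applyLeft (C.enc i) ρ) c := by
  have : Nonempty (Fin M) := ⟨⟨0, hM⟩⟩
  have hM' : (0 : ℝ) < M := by exact_mod_cast hM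
  set Q := (1 : Matrix α α ℂ) ⊗ₖ reducedRight ρ with hQ
  have h1 : ∀ i, (C.dec i * applyLeft (C.enc i) ρ).trace.re - c * (C.dec i * Q).trace.re ≤
      testValue (applyLeft (C.enc i) ρ) c := fun i => by
    have h := le_testValue ((C.enc_isCPTP i).isState_applyLeft hρ).posSemidef
      (C.dec_posSemidef i) (C.one_sub_dec_posSemidef i) c
    rwa [(C.enc_isCPTP i).reducedRight_applyLeft] at h
  -- The decoding operators share the total trace of Q, which is dim A.
  have h2 : ∑ i, (C.dec i * Q).trace.re ≤ Fintype.card α := by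
    have h := re_trace_mul_le_of_le (Matrix.le_iff.2 C.dec_sum_le_one)
      (posSemidef_one_kronecker_reducedRight hρ.posSemidef)
    rwa [one_mul, trace_one_kronecker_reducedRight hρ, Complex.natCast_re, Finset.sum_mul,
      Matrix.trace_sum, Complex.re_sum] at h
  have h3 : (M : ℝ) * C.error ρ = M - ∑ i, (C.dec i * applyLeft (C.enc i) ρ).trace.re := by
    rw [DenseCode.error, ← mul_assoc, mul_one_div_cancel hM'.ne', one_mul, Finset.sum_sub_distrib]
    simp [fun i => Matrix.trace_mul_comm (C.dec i)]
  have h4 : ∑ _i : Fin M, (1 - C.error ρ - c * Fintype.card α / M) ≤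
      ∑ i, testValue (applyLeft (C.enc i) ρ) c := by
    refine le_trans ?_ (Finset.sum_le_sum fun i _ => h1 i)
    rw [Finset.sum_sub_distrib (fun i => (C.dec i * applyLeft (C.enc i) ρ).trace.re),
      ← Finset.mul_sum, Finset.sum_const, Finset.card_univ, Fintype.card_fin, nsmul_eq_mul,
      mul_sub, mul_sub, h3, mul_div_cancel₀ _ hM'.ne']
    have := mul_le_mul_of_nonneg_left h2 hc
    linarith
  obtain ⟨i, -, hi⟩ := Finset.exists_le_of_sum_le Finset.univ_nonempty h4
  exact ⟨i, hi⟩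

end OneShot

/-! ### Spectral rates -/

section Rates

theorem liminf_coe_eq_one_iff {u : ℕ → ℝ} (hu : ∀ n, u n ≤ 1) :
    liminf (fun n => (u n : EReal)) atTop = 1 ↔ Tendsto u atTop (𝓝 1) := by
  rw [← EReal.tendsto_coe]
  refine ⟨fun h => ?_, fun h => h.liminf_eq⟩
  refine tendsto_of_le_liminf_of_limsup_le (le_of_eq (by rw [h]; rfl)) ?_
  exact limsup_le_of_le (by isBoundedDefault) (.of_forall fun n => by exact_mod_cast hu n)

variable {α β : ℕ → Type*} [∀ n, Fintype (α n)] [∀ n, DecidableEq (α n)] [∀ n, Fintype (β n)]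
  [∀ n, DecidableEq (β n)]

/-- The rates `γ` that are admissible in the definition of the spectral inf-divergence rate. -/
def IsSpectralRate (σ : ∀ n, Matrix (α n × β n) (α n × β n) ℂ) (γ : ℝ) : Prop :=
  Tendsto (fun n : ℕ => testValue (σ n) (Real.exp (n * γ))) atTop (𝓝 1)

theorem spectralSupCondEntropy_eq {σ : ∀ n, Matrix (α n × β n) (α n × β n) ℂ}
    (hσ : ∀ n, IsState (σ n)) :
    spectralSupCondEntropy σ = -⨆ γ ∈ {γ : ℝ | IsSpectralRate σ γ}, (γ : EReal) := by
  have h : {γ : ℝ | IsSpectralRate σ γ} = {γ : ℝ | liminf (fun n : ℕ =>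
      (((nonnegProj (differenceOp σ (fun n => (1 : Matrix (α n) (α n) ℂ) ⊗ₖ reducedRight (σ n)) γ n)
        * differenceOp σ (fun n => (1 : Matrix (α n) (α n) ℂ) ⊗ₖ reducedRight (σ n)) γ n).trace.re
          : ℝ) : EReal)) atTop = 1} := by
    ext γ
    exact (liminf_coe_eq_one_iff fun n => testValue_le_one (hσ n) (Real.exp_pos _).le).symm
  rw [h]
  rfl

end Rates

section Rates

variable {α β : ℕ → Type*} [∀ n, Fintype (α n)] [∀ n, DecidableEq (α n)] [∀ n, Fintype (β n)]
  [∀ n, DecidableEq (β n)]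

theorem IsState.nonempty_left {ι κ : Type*} [Fintype ι] [Fintype κ]
    {σ : Matrix (ι × κ) (ι × κ) ℂ} (hσ : IsState σ) : Nonempty ι := by
  by_contra h
  rw [not_nonempty_iff] at h
  have := hσ.trace_eq_one
  simp [Matrix.trace] at this

/-- Whether the endpoint `a` itself belongs to S is immaterial. -/
theorem iSup_coe_eq_of_forall_lt_mem {S : Set ℝ} {a : ℝ} (h : ∀ x < a, x ∈ S)
    (h' : ∀ x ∈ S, x ≤ a) : ⨆ x ∈ S, (x : EReal) = a := by
  refine le_antisymm (iSup₂_le fun x hx => by exact_mod_cast h' x hx) (le_of_forall_lt fun y hy => ?_)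
  obtain ⟨x, hyx, hxa⟩ := EReal.lt_iff_exists_real_btwn.1 hy
  exact hyx.trans_le (le_iSup₂_of_le x (h x (by exact_mod_cast hxa)) le_rfl)

/-- Take for k(n) the largest k ≤ n whose threshold N k has been passed. -/
theorem exists_diagonal {p : ℕ → ℕ → Prop} (h : ∀ k, ∀ᶠ n in atTop, p k n) :
    ∃ k : ℕ → ℕ, Tendsto k atTop atTop ∧ ∀ᶠ n in atTop, p (k n) n := by
  simp only [eventually_atTop] at h
  choose N hN using h
  refine ⟨fun n => Nat.findGreatest (fun k => N k ≤ n) n, tendsto_atTop.2 fun K => ?_, ?_⟩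
  · filter_upwards [eventually_ge_atTop (max K (N K))] with n hn
    exact Nat.le_findGreatest ((le_max_left _ _).trans hn) ((le_max_right _ _).trans hn)
  -- `Nat.findGreatest` defaults to 0, so index 0 must satisfy its own threshold.
  · filter_upwards [eventually_ge_atTop (N 0)] with n hn
    exact hN _ _ (Nat.findGreatest_spec (P := fun k => N k ≤ n) (Nat.zero_le n) hn)

variable {σ : ∀ n, Matrix (α n × β n) (α n × β n) ℂ}

theorem isSpectralRate_of_le (hσ : ∀ n, IsState (σ n)) {γ : ℝ} {u : ℕ → ℝ}
    (hu : Tendsto u atTop (𝓝 1))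
    (h : ∀ᶠ n : ℕ in atTop, u n ≤ testValue (σ n) (Real.exp (n * γ))) : IsSpectralRate σ γ :=
  tendsto_of_tendsto_of_tendsto_of_le_of_le' hu tendsto_const_nhds h
    (.of_forall fun n => testValue_le_one (hσ n) (Real.exp_pos _).le)

theorem pow_eq_exp_mul_log {d : ℕ} (hd : 0 < d) (n : ℕ) :
    ((d ^ n : ℕ) : ℝ) = Real.exp (n * Real.log d) := by
  rw [Real.exp_nat_mul, Real.exp_log (by exact_mod_cast hd), Nat.cast_pow]

theorem tendsto_exp_nat_mul_neg {x : ℝ} (hx : x < 0) :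
    Tendsto (fun n : ℕ => Real.exp (n * x)) atTop (𝓝 0) :=
  Real.tendsto_exp_atBot.comp (tendsto_natCast_atTop_atTop.atTop_mul_const_of_neg hx)

theorem isSpectralRate_of_lt_neg_log {d : ℕ} (hd : 0 < d)
    (hcard : ∀ n, Fintype.card (α n) = d ^ n) (hσ : ∀ n, IsState (σ n)) {γ : ℝ}
    (hγ : γ < -Real.log d) : IsSpectralRate σ γ := by
  refine isSpectralRate_of_le hσ (u := fun n : ℕ => 1 - Real.exp (n * (γ + Real.log d))) ?_
    (.of_forall fun n => ?_)
  · simpa using (tendsto_exp_nat_mul_neg (by linarith : γ + Real.log d < 0)).const_sub 1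
  · have h := one_sub_mul_card_le_testValue (hσ n) (Real.exp (n * γ))
    rwa [hcard, pow_eq_exp_mul_log hd, ← Real.exp_add, ← mul_add] at h

theorem IsSpectralRate.le_log {d : ℕ} (hd : 0 < d)
    (hcard : ∀ n, Fintype.card (α n) = d ^ n) (hσ : ∀ n, IsState (σ n)) {γ : ℝ}
    (hγ : IsSpectralRate σ γ) : γ ≤ Real.log d := by
  by_contra! h
  have h0 : (1 : ℝ) ≤ 0 := le_of_tendsto hγ <| .of_forall fun n => by
    have := (hσ n).nonempty_left
    refine testValue_nonpos (hσ n) ?_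
    rw [hcard, pow_eq_exp_mul_log hd]
    gcongr
  linarith

/-! ### Optimal preprocessing and the coding theorem -/

variable {ρ : ∀ n, Matrix (α n × β n) (α n × β n) ℂ}

/-- The spectral rates that Alice can reach by local preprocessing. -/
def preprocessedRates (ρ : ∀ n, Matrix (α n × β n) (α n × β n) ℂ) : Set ℝ :=
  {γ | ∃ Λ : ∀ n, Matrix (α n) (α n) ℂ →ₗ[ℂ] Matrix (α n) (α n) ℂ,
    (∀ n, IsCPTP (Λ n)) ∧ IsSpectralRate (fun n => applyLeft (Λ n) (ρ n)) γ}

/-- One preprocessing sequence reaches all rates below the supremum. -/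
theorem exists_optimal_preprocessing (hρ : ∀ n, IsState (ρ n)) {a : ℝ}
    (ha : IsLUB (preprocessedRates ρ) a) :
    ∃ Λ : ∀ n, Matrix (α n) (α n) ℂ →ₗ[ℂ] Matrix (α n) (α n) ℂ, (∀ n, IsCPTP (Λ n)) ∧
      ∀ γ < a, IsSpectralRate (fun n => applyLeft (Λ n) (ρ n)) γ := by
  have h : ∀ k : ℕ, ∃ γ ∈ preprocessedRates ρ, a - 1 / ((k : ℝ) + 1) < γ := fun k => by
    obtain ⟨γ, hγ, h1, -⟩ := ha.exists_between (sub_lt_self a (Nat.one_div_pos_of_nat (n := k)))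
    exact ⟨γ, hγ, h1⟩
  choose γ hγ hγa using h
  choose Λ hΛ hrate using hγ
  obtain ⟨k, hk, hp⟩ := exists_diagonal (p := fun k n => 1 - 1 / ((k : ℝ) + 1) ≤
    testValue (applyLeft (Λ k n) (ρ n)) (Real.exp (n * γ k))) fun k =>
      ((hrate k).eventually_const_lt
        (sub_lt_self 1 (Nat.one_div_pos_of_nat (n := k)))).mono fun _ h => h.le
  have hk0 : Tendsto (fun n => 1 / ((k n : ℝ) + 1)) atTop (𝓝 0) :=
    tendsto_one_div_add_atTop_nhds_zero_nat.comp hk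
  refine ⟨fun n => Λ (k n) n, fun n => hΛ _ _, fun γ' hγ' => ?_⟩
  refine isSpectralRate_of_le (fun n => (hΛ _ _).isState_applyLeft (hρ n))
    (u := fun n => 1 - 1 / ((k n : ℝ) + 1)) (by simpa using hk0.const_sub 1) ?_
  filter_upwards [hp, hk0.eventually_lt_const (sub_pos.2 hγ')] with n h1 h2
  -- Eventually γ (k n) > a - 1/(k n + 1) > γ', so monotonicity passes the bound at γ (k n) on to
  -- γ'.
  refine h1.trans (testValue_anti ((hΛ _ _).isState_applyLeft (hρ n)) (Real.exp_pos _).le ?_)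
  have := hγa (k n)
  gcongr
  linarith

/-- Direct part of the coding theorem. -/
theorem isAchievableRate_of_mem_preprocessedRates {d : ℕ} (hd : 0 < d)
    (hcard : ∀ n, Fintype.card (α n) = d ^ n) (hρ : ∀ n, IsState (ρ n)) {γ R : ℝ}
    (hγ : γ ∈ preprocessedRates ρ) (hR : R ≤ Real.log d + γ) : IsAchievableRate ρ R := by
  obtain ⟨Λ, hΛ, hrate⟩ := hγ
  have hC : ∀ n : ℕ, ∃ C : DenseCode (α n) (β n) ⌈Real.exp (n * R)⌉₊, C.error (ρ n) ≤
      6 * (1 - testValue (applyLeft (Λ n) (ρ n)) (Real.exp (n * γ))) +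
        4 * (1 / ((n : ℝ) + 1)) := by
    intro n
    have := (hρ n).nonempty_left
    obtain ⟨C, hC⟩ := exists_denseCode_error_le (hρ n) (hΛ n)
      (Nat.ceil_pos.2 (Real.exp_pos (n * R))) (Real.exp_pos (n * γ))
      (Nat.one_div_pos_of_nat (n := n) (α := ℝ))
    refine ⟨C, hC.trans ?_⟩
    have hv := testValue_le_one ((hΛ n).isState_applyLeft (hρ n)) (Real.exp_pos (n * γ)).le
    set v := testValue (applyLeft (Λ n) (ρ n)) (Real.exp (n * γ))
    -- M - 1 ≤ e^{nR} ≤ e^{nγ} d^n cancels both denominators. The false-alarm term is then at most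
    -- 4(1 - v), which with the 2(1 - v) for missed detection gives the constant 6; δ is 1/(n+1).
    have h1 : ((⌈Real.exp (n * R)⌉₊ : ℝ) - 1) * ((1 - v) / Real.exp (n * γ) /
        (Fintype.card (α n) : ℝ)) ≤ 1 - v := by
      have h2 : (⌈Real.exp (n * R)⌉₊ : ℝ) - 1 ≤ Real.exp (n * R) := by
        have := Nat.ceil_lt_add_one (Real.exp_pos (n * R)).le
        linarith
      have h3 : Real.exp (n * R) ≤ Real.exp (n * γ) * Real.exp (n * Real.log d) := by
        rw [← Real.exp_add, ← mul_add]
        gcongr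
        linarith
      rw [hcard, pow_eq_exp_mul_log hd, div_div, mul_div_assoc', div_le_iff₀ (by positivity),
        mul_comm (1 - v)]
      exact mul_le_mul_of_nonneg_right (h2.trans h3) (by linarith)
    linarith
  choose C hC using hC
  refine ⟨_, C, ⟨0, fun n _ => Nat.le_ceil _⟩, ?_⟩
  refine squeeze_zero (fun n => (C n).error_nonneg (hρ n)) hC ?_
  have h := ((hrate.const_sub 1).const_mul 6).add
    ((tendsto_one_div_add_atTop_nhds_zero_nat (𝕜 := ℝ)).const_mul 4)
  simpa using h

/-- Converse part of the coding theorem. -/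
theorem IsAchievableRate.mem_preprocessedRates {d : ℕ} (hd : 0 < d)
    (hcard : ∀ n, Fintype.card (α n) = d ^ n) (hρ : ∀ n, IsState (ρ n)) {R δ : ℝ}
    (hR : IsAchievableRate ρ R) (hδ : 0 < δ) : R - Real.log d - δ ∈ preprocessedRates ρ := by
  obtain ⟨M, C, ⟨N, hN⟩, herr⟩ := hR
  have h : ∀ n, ∃ Λ : Matrix (α n) (α n) ℂ →ₗ[ℂ] Matrix (α n) (α n) ℂ, IsCPTP Λ ∧
      (N ≤ n → 1 - (C n).error (ρ n) - Real.exp (n * -δ) ≤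
        testValue (applyLeft Λ (ρ n)) (Real.exp (n * (R - Real.log d - δ)))) := by
    intro n
    by_cases hn : N ≤ n
    · have hM := hN n hn
      have hM0 : (0 : ℝ) < M n := (Real.exp_pos _).trans_le hM
      obtain ⟨i, hi⟩ := (C n).exists_le_testValue (by exact_mod_cast hM0) (hρ n)
        (Real.exp_pos (n * (R - Real.log d - δ))).le
      refine ⟨_, (C n).enc_isCPTP i, fun _ => le_trans ?_ hi⟩
      rw [hcard, pow_eq_exp_mul_log hd, ← Real.exp_add]
      gcongr
      -- Here c d^n = e^{n(R-δ)} and M ≥ e^{nR}, so the loss c d^n/M is at most e^{-nδ}.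
      rw [div_le_iff₀ hM0]
      refine le_trans (le_of_eq ?_) (mul_le_mul_of_nonneg_left hM (Real.exp_pos _).le)
      rw [← Real.exp_add]
      ring_nf
    · exact ⟨_, IsCPTP.id, fun h => absurd h hn⟩
  choose Λ hΛ hv using h
  refine ⟨Λ, hΛ, isSpectralRate_of_le (fun n => (hΛ n).isState_applyLeft (hρ n))
    (u := fun n : ℕ => 1 - (C n).error (ρ n) - Real.exp (n * -δ)) ?_
    ((eventually_ge_atTop N).mono hv)⟩
  simpa using (herr.const_sub 1).sub (tendsto_exp_nat_mul_neg (neg_lt_zero.2 hδ))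

end Rates

theorem theorem5 {α β : ℕ → Type*} [∀ n, Fintype (α n)] [∀ n, DecidableEq (α n)]
    [∀ n, Fintype (β n)] [∀ n, DecidableEq (β n)]
    (d : ℕ) (hd : ∀ n, Fintype.card (α n) = d ^ n)
    (ρ : ∀ n, Matrix (α n × β n) (α n × β n) ℂ) (hρ : ∀ n, IsState (ρ n)) :
    ∃ s : ℝ,
      IsLeast {S : EReal | ∃ Λ : ∀ n, Matrix (α n) (α n) ℂ →ₗ[ℂ] Matrix (α n) (α n) ℂ,
        (∀ n, IsCPTP (Λ n)) ∧
          S = spectralSupCondEntropy (fun n => applyLeft (Λ n) (ρ n))} (s : EReal) ∧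
      denseCodingCapacity ρ = ((Real.log d - s : ℝ) : EReal) := by
  -- A state has trace one, so Alice's space at n = 1, of dimension d, is nonzero.
  have hd0 : 0 < d := by
    have := (hρ 1).nonempty_left
    have h := Fintype.card_pos (α := α 1)
    rwa [hd, pow_one] at h
  have hst : ∀ {Λ : ∀ n, Matrix (α n) (α n) ℂ →ₗ[ℂ] Matrix (α n) (α n) ℂ},
      (∀ n, IsCPTP (Λ n)) → ∀ n, IsState (applyLeft (Λ n) (ρ n)) :=
    fun hΛ n => (hΛ n).isState_applyLeft (hρ n)
  have hne : (preprocessedRates ρ).Nonempty :=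
    ⟨-Real.log d - 1, fun _ => LinearMap.id, fun _ => IsCPTP.id,
      isSpectralRate_of_lt_neg_log hd0 hd (hst fun _ => IsCPTP.id) (by linarith)⟩
  have hbdd : BddAbove (preprocessedRates ρ) :=
    ⟨Real.log d, fun γ ⟨_, hΛ, hγ⟩ => hγ.le_log hd0 hd (hst hΛ)⟩
  obtain ⟨a, ha⟩ : ∃ a, IsLUB (preprocessedRates ρ) a := ⟨_, isLUB_csSup hne hbdd⟩
  refine ⟨-a, ⟨?_, ?_⟩, ?_⟩
  · obtain ⟨Λ, hΛ, hrate⟩ := exists_optimal_preprocessing hρ ha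
    refine ⟨Λ, hΛ, ?_⟩
    rw [spectralSupCondEntropy_eq (hst hΛ),
      iSup_coe_eq_of_forall_lt_mem
        (S := {γ | IsSpectralRate (fun n => applyLeft (Λ n) (ρ n)) γ}) hrate
        fun γ hγ => ha.1 ⟨Λ, hΛ, hγ⟩, EReal.coe_neg]
  · rintro _ ⟨Λ, hΛ, rfl⟩
    rw [spectralSupCondEntropy_eq (hst hΛ), EReal.coe_neg, EReal.neg_le_neg_iff]
    exact iSup₂_le fun γ hγ => EReal.coe_le_coe_iff.2 (ha.1 ⟨Λ, hΛ, hγ⟩)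
  · refine iSup_coe_eq_of_forall_lt_mem (fun R hR => ?_) fun R hR => ?_
    · obtain ⟨γ, hγ, h, -⟩ := ha.exists_between (show R - Real.log d < a by linarith)
      exact isAchievableRate_of_mem_preprocessedRates hd0 hd hρ hγ (by linarith)
    -- The converse loses an arbitrarily small δ in the rate, which the supremum does not see.
    · refine le_of_forall_pos_le_add fun δ hδ => ?_
      have := ha.1 (IsAchievableRate.mem_preprocessedRates hd0 hd hρ hR hδ)
      linarith
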